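/- Let $N=[n]$ be a set of agents and $G$ a finite set of goods. Each agent $i$ has a positive real weight $w_i$ and a valuation $v_i:2^G\to\mathbb{R}$ that is a matroid rank function: $v_i(\emptyset)=0$; $v_i(S\cup\{g\})-v_i(S)\in\{0,1\}$ for all $S\subseteq G$, $g\in G$; and $v_i(S\cup\{g\})-v_i(S)\ge v_i(T\cup\{g\})-v_i(T)$ for all $S\subseteq T\subseteq G$, $g\in G$. An allocation is a partition $X=(X_0,X_1,\dots,X_n)$ of $G$ into $n+1$ possibly empty sets; agent $i$ gets $X_i$, and $X_0$ is the set of unallocated goods. Put $v_0(S)=|S|$. The exchange graph $\mathcal{G}(X)$ is the directed graph on $G$ with an edge from $g\in X_k$ ($0\le k\le n$) to $g'\neq g$ whenever $v_k((X_k\setminus\{g\})\cup\{g'\})=v_k(X_k)$. Let $F_i(X)=\{g\in G: v_i(X_i\cup\{g\})-v_i(X_i)=1\}$. For a path $P=(g_1,\dots,g_t)$ put $X_k\Lambda P=(X_k\setminus\{g_t\})\oplus\bigcup\{\{g_j,g_{j+1}\}: 1\le j<t,\ g_j\in X_k\}$, where $\oplus$ is the symmetric difference. A vector $x\in\mathbb{R}^c$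 lexicographically dominates $y\in\mathbb{R}^c$ if for some $k$ we have $x_k>y_k$ and $x_j=y_j$ for all $j<k$. General Yankee Swap with the gain function $\phi(X,i)=\left(-\frac{v_i(X_i)}{w_i},\,-w_i\right)$ starts with $X=(G,\emptyset,\dots,\emptyset)$ and $U=N$. While $U\ne\emptyset$, it lets $i$ be the agent of least index among those $k\in U$ that maximize $\phi(X,k)$ in the lexicographic order. If $\mathcal{G}(X)$ contains a path from $F_i(X)$ to $X_0$, it takes a shortest such path $P=(g_1,\dots,g_t)$ (any one of them) and simultaneously replaces $X_i$ by $X_i\Lambda P\cup\{g_1\}$ and $X_k$ by $X_k\Lambda P$ for all $k\in\{0,\dots,n\}\setminus\{i\}$; otherwise it removes $i$ from $U$. When $U=\emptyset$, it returns $X$. **Theorem.** General Yankee Swap with this $\phi$ always terminates, and whichever shortest paths it uses, the returned $X$ is a weighted leximin allocation: $X$ is an allocation and, writing $\vec e^{\,Z}$ for the vector $\left(\frac{v_1(Z_1)}{w_1},\dots,\frac{v_n(Z_n)}{w_n}\right)$ sorted in ascending order, there is no allocation $Y$ such that $\vec e^{\,Y}$ lexicographically dominates $\vec e^{\,X}$.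 -/

import Mathlib

namespace YankeeSwap

/-- `f` is a matroid rank function on the subsets of `G` (a binary submodular valuation). -/
structure IsMRF {G : Type*} [DecidableEq G] (f : Finset G → ℝ) : Prop where
  empty : f ∅ = 0
  marginal : ∀ (S : Finset G) (g : G), f (insert g S) - f S = 0 ∨ f (insert g S) - f S = 1
  submodular : ∀ (S T : Finset G) (g : G), S ⊆ T →
    f (insert g T) - f T ≤ f (insert g S) - f S

/-- Bundles `(X₀, X₁, …, Xₙ)`: the agents are the elements of `Fin n`, agent `i` holds
`X (some i)`, and `X none` is the pool `X₀` of unallocated goods. -/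
abbrev Bundles (n : ℕ) (G : Type*) := Option (Fin n) → Finset G

/-- An allocation: the `n + 1` (possibly empty) bundles partition the set of goods. -/
def IsAllocation {n : ℕ} {G : Type*} (X : Bundles n G) : Prop :=
  ∀ g : G, ∃! k : Option (Fin n), g ∈ X k

/-- The utility vector `(v₁(X₁), …, vₙ(Xₙ))`. -/
def utility {n : ℕ} {G : Type*} (v : Fin n → Finset G → ℝ) (X : Bundles n G) : Fin n → ℝ :=
  fun i => v i (X (some i))

/-- The valuations with the pool included as an agent, whose valuation is the cardinality. -/
def extValuation {n : ℕ} {G : Type*} (v : Fin n → Finset G → ℝ) :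
    Option (Fin n) → Finset G → ℝ
  | none => fun S => (S.card : ℝ)
  | some i => v i

/-- `x` lexicographically dominates `y`. -/
def LexDominates {c : ℕ} (x y : Fin c → ℝ) : Prop :=
  ∃ k : Fin c, (∀ j : Fin c, j < k → x j = y j) ∧ y k < x k

section ExchangeGraph

variable {n : ℕ} {G : Type*} [DecidableEq G]

/-- The exchange graph of `X`: there is an edge from `g ∈ X k` to another good `g'` if replacing
`g` by `g'` does not change the value of the bundle of `k` (`k` an agent or the pool). -/
def ExchangeEdge (v : Fin n → Finset G → ℝ) (X : Bundles n G) (g g' : G) : Prop :=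
  g ≠ g' ∧ ∃ k : Option (Fin n), g ∈ X k ∧
    extValuation v k (insert g' ((X k).erase g)) = extValuation v k (X k)

/-- `Fᵢ(X)`: the goods that give agent `i` a marginal gain of `1`. -/
def desired (v : Fin n → Finset G → ℝ) (X : Bundles n G) (i : Fin n) : Set G :=
  {g | v i (insert g (X (some i))) - v i (X (some i)) = 1}

/-- `P 0, …, P t` is a directed path (repeated vertices allowed) in the exchange graph from
`Fᵢ(X)` to the pool `X₀`. -/
def IsTransferPath (v : Fin n → Finset G → ℝ) (X : Bundles n G) (i : Fin n) (t : ℕ)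
    (P : Fin (t + 1) → G) : Prop :=
  P 0 ∈ desired v X i ∧ P (Fin.last t) ∈ X none ∧
    ∀ j : Fin t, ExchangeEdge v X (P j.castSucc) (P j.succ)

/-- A shortest path from `Fᵢ(X)` to `X₀`. Being shortest, it repeats no vertex. -/
def IsShortestTransferPath (v : Fin n → Finset G → ℝ) (X : Bundles n G) (i : Fin n) (t : ℕ)
    (P : Fin (t + 1) → G) : Prop :=
  IsTransferPath v X i t P ∧
    ∀ (t' : ℕ) (P' : Fin (t' + 1) → G), IsTransferPath v X i t' P' → t ≤ t'

variable [Fintype G]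

/-- Path augmentation of the bundle `B` with the path `P`:
`(B - P t) ⊕ {P j, P (j + 1) : P j ∈ B}`, with `⊕` the symmetric difference. -/
def augmentBundle {t : ℕ} (B : Finset G) (P : Fin (t + 1) → G) : Finset G :=
  symmDiff (B.erase (P (Fin.last t)))
    (Finset.univ.filter fun a =>
      ∃ j : Fin t, P j.castSucc ∈ B ∧ (a = P j.castSucc ∨ a = P j.succ))

/-- Augment every bundle with `P`, and give the first good of `P` to agent `i`. -/
def transfer {t : ℕ} (X : Bundles n G) (i : Fin n) (P : Fin (t + 1) → G) : Bundles n G :=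
  fun k => if k = some i then insert (P 0) (augmentBundle (X k) P) else augmentBundle (X k) P

end ExchangeGraph

section Algorithm

variable {n b : ℕ} {G : Type*} [DecidableEq G] [Fintype G]

/-- `i` is the agent picked by the algorithm: the agent of least index among the agents `k ∈ U`
that maximize the gain `φ(X, k)`, gains being compared lexicographically. -/
def IsPicked (v : Fin n → Finset G → ℝ) (φ : (Fin n → ℝ) → Fin n → Fin b → ℝ)
    (X : Bundles n G) (U : Finset (Fin n)) (i : Fin n) : Prop :=
  IsLeast {k | k ∈ U ∧ ∀ j ∈ U, ¬ LexDominates (φ (utility v X) j) (φ (utility v X) k)} i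

/-- One iteration of the loop of General Yankee Swap with gain function `φ`; a state is a pair
`(X, U)`. Any shortest path may be used. There is no iteration from a state with `U = ∅`. -/
inductive Step (v : Fin n → Finset G → ℝ) (φ : (Fin n → ℝ) → Fin n → Fin b → ℝ) :
    Bundles n G × Finset (Fin n) → Bundles n G × Finset (Fin n) → Prop
  | augment (X : Bundles n G) (U : Finset (Fin n)) (i : Fin n) (t : ℕ) (P : Fin (t + 1) → G)
      (hi : IsPicked v φ X U i) (hP : IsShortestTransferPath v X i t P) :
      Step v φ (X, U) (transfer X i P, U)
  | remove (X : Bundles n G) (U : Finset (Fin n)) (i : Fin n)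
      (hi : IsPicked v φ X U i) (hP : ∀ (t : ℕ) (P : Fin (t + 1) → G), ¬ IsTransferPath v X i t P) :
      Step v φ (X, U) (X, U.erase i)

/-- The initial state: all goods are in the pool and all agents are in `U`. -/
def initialState (n : ℕ) (G : Type*) [Fintype G] : Bundles n G × Finset (Fin n) :=
  (fun k => if k = none then Finset.univ else ∅, Finset.univ)

/-- The state `s` occurs in some run of General Yankee Swap. -/
def Reachable (v : Fin n → Finset G → ℝ) (φ : (Fin n → ℝ) → Fin n → Fin b → ℝ)
    (s : Bundles n G × Finset (Fin n)) : Prop :=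
  Relation.ReflTransGen (Step v φ) (initialState n G) s

/-- General Yankee Swap terminates: no run is infinite, and no run gets stuck while `U ≠ ∅`. -/
def Terminates (v : Fin n → Finset G → ℝ) (φ : (Fin n → ℝ) → Fin n → Fin b → ℝ) : Prop :=
  (¬ ∃ s : ℕ → Bundles n G × Finset (Fin n),
      s 0 = initialState n G ∧ ∀ r, Step v φ (s r) (s (r + 1))) ∧
    ∀ s, Reachable v φ s → s.2.Nonempty → ∃ s', Step v φ s s'

/-- `X` is returned by some run of General Yankee Swap. -/
def IsOutput (v : Fin n → Finset G → ℝ) (φ : (Fin n → ℝ) → Fin n → Fin b → ℝ)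
    (X : Bundles n G) : Prop :=
  Reachable v φ (X, ∅)

end Algorithm

section WeightedLeximin

variable {n : ℕ} {G : Type*}

/-- The weighted utilities `vᵢ(Xᵢ) / wᵢ`. -/
noncomputable def weightedUtility (v : Fin n → Finset G → ℝ) (w : Fin n → ℝ)
    (X : Bundles n G) : Fin n → ℝ :=
  fun i => v i (X (some i)) / w i

/-- The weighted sorted utility vector: the weighted utilities in ascending order. -/
noncomputable def sortedWeightedUtility (v : Fin n → Finset G → ℝ) (w : Fin n → ℝ)
    (X : Bundles n G) : Fin n → ℝ :=
  weightedUtility v w X ∘ Tuple.sort (weightedUtility v w X)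

/-- `X` is a weighted leximin allocation. -/
def IsWeightedLeximin (v : Fin n → Finset G → ℝ) (w : Fin n → ℝ) (X : Bundles n G) : Prop :=
  IsAllocation X ∧ ∀ Y : Bundles n G, IsAllocation Y →
    ¬ LexDominates (sortedWeightedUtility v w Y) (sortedWeightedUtility v w X)

/-- The gain function `φ(x, i) = (-xᵢ / wᵢ, -wᵢ)` of a utility vector `x` and an agent `i`. -/
noncomputable def weightedLeximinGain (w : Fin n → ℝ) : (Fin n → ℝ) → Fin n → Fin 2 → ℝ :=
  fun x i => ![-(x i / w i), -w i]

end WeightedLeximin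

end YankeeSwap

/-! Give an agent `i` of utility `m` the key `(m / wᵢ, wᵢ)`; the loop always serves a least key of
`U`.

Combinatorial half. The exchanges along a shortest path can all be carried out at once, so bundles
stay valued at their cardinality and only the picked agent gains, by one unit
(`IsNonredundant.transfer`). If there is no path, the set `R` of goods reachable from `Fᵢ(X)` is a
dual certificate as in matroid union: `i` and the owners of `R` together already have the largest
total utility that any allocation gives them (`exists_isTight`, `IsTight.sum_le`). Such tight sets
survive later augmentations and are closed under union. As least keys are served, the last unit of
every agent was given at a key no greater than the present key of each agent in `U`; when an agent
leaves `U`, this comparison is frozen on its tight set (`Invariant`).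

Analytic half. If the utilities `y` of an allocation dominated the output `u`, then `∑ exp (-s yₖ /
wₖ)` would be less than `∑ exp (-s uₖ / wₖ)` for all large `s`. These sums are separable and convex,
and for large `s` their marginal decreases are ordered by the keys, ties included. Hence each agent
has a price `lₖ` between its next and its last decrease such that the superlevel sets of `l` are
unions of tight sets. On such unions `y` has no larger total than `u`, so `∑ lₖ (yₖ - uₖ) ≤ 0`, and
by convexity this quantity bounds the second sum minus the first, a contradiction
(`not_lexDominates_of_tight`). -/

namespace YankeeSwap

/-! ### Matroid rank functions and simultaneous exchanges -/

namespace IsMRF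

variable {G : Type*} [DecidableEq G] {f : Finset G → ℝ}

lemma le_insert (hf : IsMRF f) (S : Finset G) (g : G) : f S ≤ f (insert g S) := by
  rcases hf.marginal S g with h | h <;> linarith

lemma insert_le (hf : IsMRF f) (S : Finset G) (g : G) : f (insert g S) ≤ f S + 1 := by
  rcases hf.marginal S g with h | h <;> linarith

lemma union_le_add_card (hf : IsMRF f) (S T : Finset G) : f (S ∪ T) ≤ f S + T.card := by
  induction T using Finset.induction_on with
  | empty => simp
  | insert g T hg ih =>
    rw [Finset.union_insert, Finset.card_insert_of_notMem hg]
    push_cast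
    linarith [hf.insert_le (S ∪ T) g]

lemma le_union (hf : IsMRF f) (S T : Finset G) : f S ≤ f (S ∪ T) := by
  induction T using Finset.induction_on with
  | empty => simp
  | insert g T hg ih =>
    rw [Finset.union_insert]
    exact ih.trans (hf.le_insert _ _)

lemma mono (hf : IsMRF f) {S T : Finset G} (h : S ⊆ T) : f S ≤ f T := by
  rw [← Finset.union_eq_right.mpr h]
  exact hf.le_union S T

lemma le_card (hf : IsMRF f) (S : Finset G) : f S ≤ S.card := by
  simpa [hf.empty] using hf.union_le_add_card ∅ S

lemma exists_nat (hf : IsMRF f) (S : Finset G) : ∃ m : ℕ, f S = m := by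
  induction S using Finset.induction_on with
  | empty => exact ⟨0, by simp [hf.empty]⟩
  | insert g S hg ih =>
    obtain ⟨m, hm⟩ := ih
    rcases hf.marginal S g with h | h
    · exact ⟨m, by linarith⟩
    · exact ⟨m + 1, by push_cast; linarith⟩

lemma union_sub_le (hf : IsMRF f) {S T : Finset G} (h : S ⊆ T) (W : Finset G) :
    f (T ∪ W) - f T ≤ f (S ∪ W) - f S := by
  induction W using Finset.induction_on with
  | empty => simp
  | insert g W hg ih =>
    rw [Finset.union_insert, Finset.union_insert]
    linarith [hf.submodular (S ∪ W) (T ∪ W) g (Finset.union_subset_union_left h)]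

lemma union_add_inter_le (hf : IsMRF f) (S T : Finset G) :
    f (S ∪ T) + f (S ∩ T) ≤ f S + f T := by
  have h := hf.union_sub_le (Finset.inter_subset_left : S ∩ T ⊆ S) T
  rw [Finset.union_eq_right.mpr (Finset.inter_subset_right : S ∩ T ⊆ T)] at h
  linarith

lemma union_eq_of_insert_le (hf : IsMRF f) (S W : Finset G)
    (h : ∀ g ∈ W, f (insert g S) ≤ f S) : f (S ∪ W) ≤ f S := by
  induction W using Finset.induction_on with
  | empty => simp
  | insert g W hg ih =>
    rw [Finset.union_insert]
    have h1 := hf.submodular S (S ∪ W) g Finset.subset_union_left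
    have h2 := h g (by simp)
    have h3 := ih fun a ha => h a (by simp [ha])
    linarith

lemma eq_card_of_subset (hf : IsMRF f) {S I : Finset G} (hI : f I = I.card) (h : S ⊆ I) :
    f S = S.card := by
  refine le_antisymm (hf.le_card S) ?_
  have h1 := hf.union_le_add_card S (I \ S)
  rw [Finset.union_sdiff_of_subset h, hI, ← Finset.card_sdiff_add_card_eq_card h] at h1
  push_cast at h1
  linarith

/-- An element whose fundamental circuit in the independent set `I` avoids `A` is spanned by
`I \ A`. -/
lemma insert_sdiff_le (hf : IsMRF f) {I A : Finset G} {b : G} (hI : f I = I.card) (hA : A ⊆ I)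
    (hne : A.Nonempty)
    (h : ∀ a ∈ A, f (insert b (I.erase a)) ≤ (I.card : ℝ) - 1) :
    f (insert b (I \ A)) ≤ (I.card : ℝ) - A.card := by
  induction hne using Finset.Nonempty.cons_induction with
  | singleton a =>
    simpa [Finset.sdiff_singleton_eq_erase] using h a
  | cons a A ha hne ih =>
    rw [Finset.cons_eq_insert] at *
    have ih' := ih (fun x hx => hA (by simp [hx])) (fun x hx => h x (by simp [hx]))
    have h1 := h a (by simp)
    -- The union contains `I`, so it has rank at least `I.card`; the intersection is the set to be
    -- bounded.
    have h2 := hf.union_add_inter_le (insert b (I \ A)) (insert b (I.erase a))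
    have h3 : insert b (I \ A) ∩ insert b (I.erase a) = insert b (I \ insert a A) := by
      ext x; simp only [Finset.mem_inter, Finset.mem_insert, Finset.mem_sdiff, Finset.mem_erase]
      tauto
    have h4 : I ⊆ insert b (I \ A) ∪ insert b (I.erase a) := by
      intro x hx
      simp only [Finset.mem_union, Finset.mem_insert, Finset.mem_sdiff, Finset.mem_erase]
      by_cases hxa : x = a
      · subst hxa; tauto
      · tauto
    have h5 := hf.mono h4
    rw [h3] at h2
    rw [Finset.card_insert_of_notMem ha]
    push_cast
    linarith

lemma insert_erase_le (hf : IsMRF f) {I : Finset G} {a b : G} (hI : f I = I.card) (ha : a ∈ I)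
    (h : f (insert b (I.erase a)) ≠ f I) : f (insert b (I.erase a)) ≤ (I.card : ℝ) - 1 := by
  have h1 : f (I.erase a) = (I.card : ℝ) - 1 := by
    rw [hf.eq_card_of_subset hI (Finset.erase_subset _ _), Finset.card_erase_of_mem ha,
      Nat.cast_sub (Finset.card_pos.mpr ⟨a, ha⟩)]
    simp
  rcases hf.marginal (I.erase a) b with h2 | h2
  · linarith
  · exact absurd (by linarith) h

lemma erase_ne (hf : IsMRF f) {I : Finset G} {a : G} (hI : f I = I.card) (ha : a ∈ I) :
    f (I.erase a) ≠ f I := by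
  rw [hf.eq_card_of_subset hI (Finset.erase_subset _ _), Finset.card_erase_of_mem ha, hI,
    Nat.cast_sub (Finset.card_pos.mpr ⟨a, ha⟩)]
  simp

/-- The set obtained from `I` by performing the exchanges `p j → p (j + 1)` for all `j < l` with
`p j ∈ I`. -/
def _root_.YankeeSwap.partialExchange (I : Finset G) (p : ℕ → G) (l : ℕ) : Finset G :=
  (I \ (Finset.range l).image p) ∪
    ((Finset.range l).filter fun j => p j ∈ I).image fun j => p (j + 1)

/-- Let `H` be `I` without `p 0, …, p l`. Both `insert (p (l + 1)) H` and its extension by `p l`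
have rank `H.card + 1`: the first by independence of the exchanged set, the second by `hspan`. So `p
l` is spanned by what remains after the exchange, and losing it costs nothing. The set `Z` is free
in order to carry along the good that the picked agent receives. -/
lemma le_partialExchange_succ (hf : IsMRF f) {I Z : Finset G} {p : ℕ → G} {l : ℕ}
    (hI : f I = I.card) (hpl : p l ∈ I) (hnew : p (l + 1) ∉ I)
    (hdist : ∀ j < l, p j ≠ p l)
    (hedge : f (insert (p (l + 1)) (I.erase (p l))) = f I)
    (hspan : f (insert (p (l + 1)) (I \ (Finset.range l).image p)) ≤
      (I \ (Finset.range l).image p).card) :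
    f (Z ∪ partialExchange I p l) ≤ f (Z ∪ partialExchange I p (l + 1)) := by
  set H := I \ (Finset.range (l + 1)).image p with hH
  have hHl : I \ (Finset.range l).image p = insert (p l) H := by
    ext x
    simp only [hH, Finset.mem_sdiff, Finset.mem_image, Finset.mem_range, Finset.mem_insert,
      Nat.lt_succ_iff]
    constructor
    · rintro ⟨hx, hx'⟩
      by_cases hxl : x = p l
      · exact Or.inl hxl
      · refine Or.inr ⟨hx, ?_⟩
        rintro ⟨j, hj, rfl⟩
        rcases hj.lt_or_eq with hj | rfl
        · exact hx' ⟨j, hj, rfl⟩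
        · exact hxl rfl
    · rintro (rfl | ⟨hx, hx'⟩)
      · exact ⟨hpl, fun ⟨j, hj, h⟩ => hdist j hj h⟩
      · exact ⟨hx, fun ⟨j, hj, h⟩ => hx' ⟨j, hj.le, h⟩⟩
  have hplH : p l ∉ H := by
    simp [hH]
    exact fun _ => ⟨l, le_rfl, rfl⟩
  have hHI : H ⊆ I.erase (p l) := fun x hx =>
    Finset.mem_erase.mpr ⟨fun h => hplH (h ▸ hx), (Finset.mem_sdiff.mp hx).1⟩
  have hcardE : (insert (p (l + 1)) (I.erase (p l))).card = I.card := by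
    rw [Finset.card_insert_of_notMem (fun h => hnew (Finset.mem_of_mem_erase h)),
      Finset.card_erase_of_mem hpl, Nat.sub_add_cancel (Finset.card_pos.mpr ⟨_, hpl⟩)]
  have h1 : f (insert (p (l + 1)) H) = H.card + 1 := by
    rw [hf.eq_card_of_subset (by rw [hedge, hcardE, hI]) (Finset.insert_subset_insert _ hHI),
      Finset.card_insert_of_notMem (fun h => hnew (Finset.mem_sdiff.mp h).1)]
    push_cast
    rfl
  rw [hHl, Finset.card_insert_of_notMem hplH] at hspan
  push_cast at hspan
  have h2 : insert (p (l + 1)) H ⊆ Z ∪ partialExchange I p (l + 1) := by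
    intro x hx
    rw [Finset.mem_insert] at hx
    simp only [partialExchange, Finset.mem_union]
    rcases hx with rfl | hx
    · refine Or.inr (Or.inr (Finset.mem_image.mpr ⟨l, ?_, rfl⟩))
      simp [hpl]
    · exact Or.inr (Or.inl hx)
  have h3 := hf.submodular _ _ (p l) h2
  rw [Finset.insert_comm] at h3
  have h4 : Z ∪ partialExchange I p l ⊆ insert (p l) (Z ∪ partialExchange I p (l + 1)) := by
    intro x hx
    simp only [partialExchange, Finset.mem_union, Finset.mem_insert] at hx ⊢
    rcases hx with hx | hx | hx
    · exact Or.inr (Or.inl hx)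
    · rw [hHl, Finset.mem_insert] at hx
      rcases hx with hx | hx
      · exact Or.inl hx
      · exact Or.inr (Or.inr (Or.inl hx))
    · refine Or.inr (Or.inr (Or.inr ?_))
      obtain ⟨j, hj, rfl⟩ := Finset.mem_image.mp hx
      simp only [Finset.mem_filter, Finset.mem_range] at hj
      exact Finset.mem_image.mpr ⟨j, by simp [hj.2]; omega, rfl⟩
  linarith [hf.mono h4]

lemma partialExchange_succ_of_notMem {I : Finset G} {p : ℕ → G} {l : ℕ} (h : p l ∉ I) :
    partialExchange I p (l + 1) = partialExchange I p l := by
  unfold partialExchange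
  rw [Finset.range_add_one, Finset.filter_insert, if_neg h, Finset.image_insert,
    Finset.sdiff_insert]
  congr 1
  rw [Finset.erase_eq_of_notMem]
  simp [h]

/-- No edge leads from `p j` past its successor, so all exchanges along `p` can be performed. -/
lemma card_le_partialExchange (hf : IsMRF f) {I : Finset G} {p : ℕ → G} {t : ℕ}
    (hI : f I = I.card) (hnew : ∀ j < t, p j ∈ I → p (j + 1) ∉ I)
    (hdist : ∀ l < t, ∀ j < l, p j ≠ p l)
    (hedge : ∀ j < t, p j ∈ I → f (insert (p (j + 1)) (I.erase (p j))) = f I)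
    (hshort : ∀ l < t, ∀ j < l, p j ∈ I → f (insert (p (l + 1)) (I.erase (p j))) ≠ f I) :
    (I.card : ℝ) ≤ f (partialExchange I p t) ∧
    ∀ g, f (insert g I) - f I = 1 →
      (∀ j < t, p j ∈ I → f (insert (p (j + 1)) I) - f I ≠ 1) →
      (I.card : ℝ) + 1 ≤ f (insert g (partialExchange I p t)) := by
  -- No edge jumps from an earlier `p m ∈ I` to `p (l + 1)`, so the latter is spanned by `I` without
  -- these goods. An earlier exchange must exist: otherwise `p (l + 1)` may lie outside the span of
  -- `I`.
  have hspan : ∀ l < t, p l ∈ I → (∃ j < l, p j ∈ I) →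
      f (insert (p (l + 1)) (I \ (Finset.range l).image p)) ≤
      (I \ (Finset.range l).image p).card := by
    rintro l hl hlI ⟨j, hj, hjI⟩
    have h := hf.insert_sdiff_le (A := I ∩ (Finset.range l).image p) hI Finset.inter_subset_left
      ⟨p j, by simp [hjI]; exact ⟨j, hj, rfl⟩⟩ (by
        intro a ha
        simp only [Finset.mem_inter, Finset.mem_image, Finset.mem_range] at ha
        obtain ⟨haI, m, hm, rfl⟩ := ha
        exact hf.insert_erase_le hI haI (hshort l hl m hm haI))
    rw [Finset.sdiff_inter_self_left] at h
    have h2 := Finset.card_sdiff_add_card_inter I ((Finset.range l).image p)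
    have h3 : ((I \ (Finset.range l).image p).card : ℝ) + (I ∩ (Finset.range l).image p).card
      = I.card := by exact_mod_cast h2
    linarith
  constructor
  · suffices ∀ l ≤ t, (I.card : ℝ) ≤ f (partialExchange I p l) from this t le_rfl
    intro l
    induction l with
    | zero => intro _; simp [partialExchange, hI]
    | succ l ih =>
      intro hl
      have ih := ih (by omega)
      by_cases hlI : p l ∈ I
      · by_cases hex : ∃ j < l, p j ∈ I
        · have h := hf.le_partialExchange_succ (Z := ∅) hI hlI (hnew l hl hlI) (hdist l hl)
            (hedge l hl hlI) (hspan l hl hlI hex)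
          simp only [Finset.empty_union] at h
          exact ih.trans h
        -- First exchange: the new set contains `I` with `p l` replaced by `p (l + 1)`, which has
        -- full rank by the edge itself.
        · push Not at hex
          rw [← hI, ← hedge l hl hlI]
          apply hf.mono
          intro x hx
          simp only [partialExchange, Finset.mem_union, Finset.mem_insert, Finset.mem_erase] at hx ⊢
          rcases hx with rfl | ⟨hx1, hx2⟩
          · exact Or.inr (Finset.mem_image.mpr ⟨l, by simp [hlI], rfl⟩)
          · refine Or.inl (Finset.mem_sdiff.mpr ⟨hx2, fun h => ?_⟩)
            obtain ⟨j, hj, rfl⟩ := Finset.mem_image.mp h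
            rcases (Nat.lt_succ_iff.mp (Finset.mem_range.mp hj)).lt_or_eq with hj | rfl
            · exact hex j hj hx2
            · exact hx1 rfl
      · rwa [partialExchange_succ_of_notMem hlI]
  · intro g hg hF
    suffices ∀ l ≤ t, (I.card : ℝ) + 1 ≤ f ({g} ∪ partialExchange I p l) from this t le_rfl
    intro l
    induction l with
    | zero =>
      intro _
      simp only [partialExchange, Finset.range_zero, Finset.image_empty, Finset.sdiff_empty,
        Finset.filter_empty, Finset.union_empty, Finset.singleton_union]
      linarith
    | succ l ih =>
      intro hl
      have ih := ih (by omega)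
      by_cases hlI : p l ∈ I
      · refine ih.trans (hf.le_partialExchange_succ hI hlI (hnew l hl hlI) (hdist l hl)
            (hedge l hl hlI) ?_)
        by_cases hex : ∃ j < l, p j ∈ I
        · exact hspan l hl hlI hex
        -- First exchange with `g` present: here `p (l + 1)` is spanned by `I` because its marginal
        -- gain is not `1`.
        · push Not at hex
          have : I \ (Finset.range l).image p = I := by
            rw [Finset.sdiff_eq_self_iff_disjoint, Finset.disjoint_right]
            intro x hx
            obtain ⟨j, hj, rfl⟩ := Finset.mem_image.mp hx
            exact hex j (Finset.mem_range.mp hj)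
          rw [this, ← hI]
          rcases hf.marginal I (p (l + 1)) with h | h
          · linarith
          · exact absurd h (hF l hl hlI)
      · rwa [partialExchange_succ_of_notMem hlI]

end IsMRF

lemma card_partialExchange_le {G : Type*} [DecidableEq G] {I : Finset G} {p : ℕ → G} {t : ℕ}
    (hdist : ∀ l < t, ∀ j < l, p j ≠ p l) : (partialExchange I p t).card ≤ I.card := by
  have h1 : (((Finset.range t).filter fun j => p j ∈ I).image p) ⊆ I := by
    intro x hx
    obtain ⟨j, hj, rfl⟩ := Finset.mem_image.mp hx
    exact (Finset.mem_filter.mp hj).2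
  have h2 : I \ (Finset.range t).image p ⊆
      I \ ((Finset.range t).filter fun j => p j ∈ I).image p :=
    Finset.sdiff_subset_sdiff le_rfl (Finset.image_subset_image (Finset.filter_subset _ _))
  have h3 : (((Finset.range t).filter fun j => p j ∈ I).image p).card =
      ((Finset.range t).filter fun j => p j ∈ I).card := by
    apply Finset.card_image_of_injOn
    intro a ha b hb hab
    simp only [Finset.coe_filter, Finset.mem_range, Set.mem_ofPred_eq] at ha hb
    rcases lt_trichotomy a b with h | h | h
    · exact absurd hab (hdist b hb.1 a h)
    · exact h
    · exact absurd hab.symm (hdist a ha.1 b h)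
  have h4 := Finset.card_image_le (s := (Finset.range t).filter fun j => p j ∈ I)
    (f := fun j => p (j + 1))
  have h5 := Finset.card_sdiff_add_card_eq_card h1
  have h6 := Finset.card_le_card h2
  have h7 := Finset.card_union_le (I \ (Finset.range t).image p)
    (((Finset.range t).filter fun j => p j ∈ I).image fun j => p (j + 1))
  unfold partialExchange
  omega

end YankeeSwap

/-! ### Shortest transfer paths -/

namespace YankeeSwap

variable {n : ℕ} {G : Type*}

lemma IsAllocation.unique {X : Bundles n G} (hX : IsAllocation X) {g : G}
    {k k' : Option (Fin n)} (h : g ∈ X k) (h' : g ∈ X k') : k = k' :=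
  (hX g).unique h h'

/-- Paths become sequences on `ℕ`, constant after `t`, so that they can be cut and shifted without
`Fin` arithmetic. -/
lemma exists_seq {t : ℕ} (P : Fin (t + 1) → G) : ∃ p : ℕ → G, P = fun j : Fin (t + 1) => p j :=
  ⟨fun j => P ⟨min j t, by omega⟩, by
    ext j
    congr 1
    ext
    simp
    omega⟩

variable [DecidableEq G]

/-- An allocation in which every agent values its bundle at its cardinality. -/
structure IsNonredundant (v : Fin n → Finset G → ℝ) (X : Bundles n G) : Prop where
  alloc : IsAllocation X
  value : ∀ i, v i (X (some i)) = (X (some i)).card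

/-- `IsTransferPath` for sequences indexed by natural numbers. -/
def IsTransferSeq (v : Fin n → Finset G → ℝ) (X : Bundles n G) (i : Fin n) (t : ℕ)
    (p : ℕ → G) : Prop :=
  p 0 ∈ desired v X i ∧ p t ∈ X none ∧ ∀ j < t, ExchangeEdge v X (p j) (p (j + 1))

lemma IsTransferSeq.isTransferPath {v : Fin n → Finset G → ℝ} {X : Bundles n G} {i : Fin n}
    {t : ℕ} {p : ℕ → G} (h : IsTransferSeq v X i t p) :
    IsTransferPath v X i t fun j => p j :=
  ⟨h.1, h.2.1, fun j => h.2.2 j j.2⟩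

lemma isTransferPath_iff {v : Fin n → Finset G → ℝ} {X : Bundles n G} {i : Fin n}
    {t : ℕ} {p : ℕ → G} :
    IsTransferPath v X i t (fun j => p j) ↔ IsTransferSeq v X i t p :=
  ⟨fun h => ⟨h.1, h.2.1, fun j hj => h.2.2 ⟨j, hj⟩⟩, fun h => h.isTransferPath⟩

/-- A transfer sequence of minimal length. -/
structure IsShortestTransferSeq (v : Fin n → Finset G → ℝ) (X : Bundles n G) (i : Fin n) (t : ℕ)
    (p : ℕ → G) : Prop where
  seq : IsTransferSeq v X i t p
  min : ∀ t' p', IsTransferSeq v X i t' p' → t ≤ t'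

lemma IsShortestTransferPath.seq {v : Fin n → Finset G → ℝ} {X : Bundles n G} {i : Fin n}
    {t : ℕ} {p : ℕ → G} (h : IsShortestTransferPath v X i t fun j => p j) :
    IsShortestTransferSeq v X i t p :=
  ⟨isTransferPath_iff.mp h.1, fun _ _ h' => h.2 _ _ h'.isTransferPath⟩

namespace IsShortestTransferSeq

variable {v : Fin n → Finset G → ℝ} {X : Bundles n G} {i : Fin n} {t : ℕ} {p : ℕ → G}

lemma notMem_pool (h : IsShortestTransferSeq v X i t p) {j : ℕ} (hj : j < t) : p j ∉ X none :=
  fun hX => absurd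
    (h.min j p ⟨h.seq.1, hX, fun m hm => h.seq.2.2 m (hm.trans hj)⟩) (by omega)

lemma notMem_desired (h : IsShortestTransferSeq v X i t p) {j : ℕ} (hj : j < t) :
    p (j + 1) ∉ desired v X i := fun hF => by
  have := h.min (t - (j + 1)) (fun m => p (m + (j + 1))) ⟨by simpa using hF, by
    simpa [Nat.sub_add_cancel hj] using h.seq.2.1, fun m hm => by
    have := h.seq.2.2 (m + (j + 1)) (by omega)
    simpa only [show m + 1 + (j + 1) = m + (j + 1) + 1 by ring] using this⟩
  omega

lemma not_edge (h : IsShortestTransferSeq v X i t p) {j l : ℕ} (hjl : j + 1 < l) (hl : l ≤ t) :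
    ¬ ExchangeEdge v X (p j) (p l) := fun hE => by
  -- The shortcut: follow `p` up to `p j`, jump to `p l`, and continue along `p`.
  have := h.min (t - (l - (j + 1))) (fun m => if m ≤ j then p m else p (m + (l - (j + 1))))
    ⟨by simpa using h.seq.1, by
      simp only [if_neg (by omega : ¬ t - (l - (j + 1)) ≤ j),
        Nat.sub_add_cancel (by omega : l - (j + 1) ≤ t)]
      exact h.seq.2.1, fun m hm => by
      rcases lt_trichotomy m j with hmj | rfl | hmj
      · simp only [if_pos hmj.le, if_pos (Nat.succ_le_of_lt hmj)]
        exact h.seq.2.2 m (by omega)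
      · simp only [le_refl, if_true, if_neg (by omega : ¬ m + 1 ≤ m)]
        rwa [Nat.add_sub_cancel' hjl.le]
      · simp only [if_neg (by omega : ¬ m ≤ j), if_neg (by omega : ¬ m + 1 ≤ j)]
        have := h.seq.2.2 (m + (l - (j + 1))) (by omega)
        rwa [show m + 1 + (l - (j + 1)) = m + (l - (j + 1)) + 1 by ring]⟩
  omega

lemma ne (h : IsShortestTransferSeq v X i t p) {j l : ℕ} (hjl : j < l) (hl : l ≤ t) :
    p j ≠ p l := fun he => by
  rcases hl.lt_or_eq with hl | rfl
  -- A repetition `p j = p l` turns the edge from `p l` to `p (l + 1)` into a chord from `p j`.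
  · exact h.not_edge (j := j) (l := l + 1) (by omega) hl (he ▸ h.seq.2.2 l hl)
  · exact h.notMem_pool hjl (he ▸ h.seq.2.1)

end IsShortestTransferSeq

lemma ExchangeEdge.eq_of_mem {v : Fin n → Finset G → ℝ} {X : Bundles n G} (hX : IsAllocation X)
    {g g' : G} (h : ExchangeEdge v X g g') {k : Fin n} (hk : g ∈ X (some k)) :
    v k (insert g' ((X (some k)).erase g)) = v k (X (some k)) := by
  obtain ⟨_, k', hg, h⟩ := h
  obtain rfl := hX.unique hg hk
  exact h

/-- Otherwise the exchange would merely delete `g` from an independent bundle and lower its rank. -/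
lemma ExchangeEdge.notMem {v : Fin n → Finset G → ℝ} (hv : ∀ i, IsMRF (v i)) {X : Bundles n G}
    (hX : IsNonredundant v X) {g g' : G} (h : ExchangeEdge v X g g') {k : Fin n}
    (hk : g ∈ X (some k)) : g' ∉ X (some k) := fun hg' => by
  have h1 := h.eq_of_mem hX.alloc hk
  rw [Finset.insert_eq_of_mem (Finset.mem_erase.mpr ⟨h.1.symm, hg'⟩)] at h1
  exact (hv k).erase_ne (hX.value k) hk h1

/-! ### Augmentation along a shortest path -/

section Augment

variable [Fintype G]

lemma augmentBundle_eq_partialExchange {I : Finset G} {t : ℕ} {p : ℕ → G} (ht : p t ∉ I)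
    (hnew : ∀ j < t, p j ∈ I → p (j + 1) ∉ I) (hne : ∀ l ≤ t, ∀ j < l, p j ≠ p l) :
    augmentBundle I (fun j : Fin (t + 1) => p j) = partialExchange I p t := by
  ext a
  simp only [augmentBundle, partialExchange, Finset.mem_symmDiff, Finset.mem_erase,
    Finset.mem_filter, Finset.mem_univ, true_and, Finset.mem_union, Finset.mem_sdiff,
    Finset.mem_image, Finset.mem_range, Fin.val_last, Fin.val_castSucc, Fin.val_succ]
  constructor
  · rintro (⟨⟨h1, h2⟩, h3⟩ | ⟨⟨j, hj, rfl | rfl⟩, h2⟩)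
    · refine Or.inl ⟨h2, ?_⟩
      rintro ⟨j, hj, rfl⟩
      exact h3 ⟨⟨j, hj⟩, h2, Or.inl rfl⟩
    · exact absurd ⟨hne t le_rfl j j.2, hj⟩ h2
    · exact Or.inr ⟨j, ⟨j.2, hj⟩, rfl⟩
  · rintro (⟨h1, h2⟩ | ⟨j, ⟨hj, hjI⟩, rfl⟩)
    · refine Or.inl ⟨⟨fun h => ht (h ▸ h1), h1⟩, ?_⟩
      rintro ⟨j, hj, rfl | rfl⟩
      · exact h2 ⟨j, j.2, rfl⟩
      · exact hnew j j.2 hj h1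
    · exact Or.inr ⟨⟨⟨j, hj⟩, hjI, Or.inr rfl⟩, fun h => hnew j hj hjI h.2⟩

lemma augmentBundle_eq_erase {I : Finset G} {t : ℕ} {p : ℕ → G} (h : ∀ j < t, p j ∉ I) :
    augmentBundle I (fun j : Fin (t + 1) => p j) = I.erase (p t) := by
  have : (Finset.univ.filter fun a => ∃ j : Fin t, p j ∈ I ∧ (a = p j ∨ a = p (j + 1))) = ∅ := by
    rw [Finset.filter_eq_empty_iff]
    rintro a _ ⟨j, hj, _⟩
    exact h j j.2 hj
  simp only [augmentBundle, Fin.val_last, Fin.val_castSucc, Fin.val_succ, this]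
  simp

variable {v : Fin n → Finset G → ℝ} {X : Bundles n G} {i : Fin n} {t : ℕ} {p : ℕ → G}

lemma transfer_some (hv : ∀ i, IsMRF (v i)) (hX : IsNonredundant v X)
    (hp : IsShortestTransferSeq v X i t p) (k : Fin n) :
    transfer X i (fun j : Fin (t + 1) => p j) (some k) =
      if k = i then insert (p 0) (partialExchange (X (some k)) p t)
      else partialExchange (X (some k)) p t := by
  have h : augmentBundle (X (some k)) (fun j : Fin (t + 1) => p j) =
      partialExchange (X (some k)) p t := by
    refine augmentBundle_eq_partialExchange (fun h => ?_)
      (fun j hj hk => (hp.seq.2.2 j hj).notMem hv hX hk) fun l hl j hj => hp.ne hj hl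
    exact absurd (hX.alloc.unique hp.seq.2.1 h) (by simp)
  simp [transfer, h]

/-- The transfer shifts ownership along the path: `p (j + 1)` goes to the owner of `p j`, `p 0` goes
to `i`, and goods off the path stay put. As the path has no repetition, every good gets exactly one
owner. -/
lemma isAllocation_transfer (hv : ∀ i, IsMRF (v i)) (hX : IsNonredundant v X)
    (hp : IsShortestTransferSeq v X i t p) :
    IsAllocation (transfer X i fun j : Fin (t + 1) => p j) := by
  choose o ho using fun g => (hX.alloc g).exists
  have hmem : ∀ g k, g ∈ X k ↔ o g = k := fun g k =>
    ⟨fun h => hX.alloc.unique (ho g) h, fun h => h ▸ ho g⟩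
  have hpool : ∀ j < t, o (p j) ≠ none := fun j hj h => hp.notMem_pool hj ((hmem _ _).mpr h)
  have hlast : o (p t) = none := (hmem _ _).mp hp.seq.2.1
  have key : ∀ g k, g ∈ transfer X i (fun j : Fin (t + 1) => p j) k ↔
      (o g = k ∧ ∀ j ≤ t, p j ≠ g) ∨ (∃ j < t, o (p j) = k ∧ p (j + 1) = g) ∨
        (k = some i ∧ g = p 0) := by
    intro g k
    cases k with
    | none =>
      have : transfer X i (fun j : Fin (t + 1) => p j) none = (X none).erase (p t) := by
        simp only [transfer, reduceCtorEq, if_false]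
        exact augmentBundle_eq_erase fun j hj => hp.notMem_pool hj
      rw [this, Finset.mem_erase, hmem]
      constructor
      · rintro ⟨h1, h2⟩
        refine Or.inl ⟨h2, fun j hj h => ?_⟩
        subst h
        rcases hj.lt_or_eq with hj | rfl
        · exact hpool j hj h2
        · exact h1 rfl
      · rintro (⟨h1, h2⟩ | ⟨j, hj, h, _⟩ | ⟨h, _⟩)
        · exact ⟨(h2 t le_rfl).symm, h1⟩
        · exact absurd h (hpool j hj)
        · cases h
    | some k =>
      have h1 : g ∈ partialExchange (X (some k)) p t ↔
          (o g = some k ∧ ∀ j ≤ t, p j ≠ g) ∨ (∃ j < t, o (p j) = some k ∧ p (j + 1) = g) := by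
        simp only [partialExchange, Finset.mem_union, Finset.mem_sdiff, Finset.mem_image,
          Finset.mem_range, Finset.mem_filter, hmem, and_assoc]
        refine or_congr (and_congr_right fun h => ?_) Iff.rfl
        constructor
        · intro h2 j hj hjg
          rcases hj.lt_or_eq with hj | rfl
          · exact h2 ⟨j, hj, hjg⟩
          · rw [← hjg, hlast] at h; cases h
        · rintro h2 ⟨j, hj, hjg⟩
          exact h2 j hj.le hjg
      rw [transfer_some hv hX hp]
      split_ifs with hk
      · rw [Finset.mem_insert, h1, hk, or_comm, or_assoc]; simp only [true_and]
      · rw [h1]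
        simp [hk]
  intro g
  simp only [key]
  by_cases hg : ∃ j ≤ t, p j = g
  · obtain ⟨j, hj, rfl⟩ := hg
    have huniq : ∀ l ≤ t, p l = p j → l = j := fun l hl h => by
      rcases lt_trichotomy l j with h' | h' | h'
      · exact absurd h (hp.ne h' hj)
      · exact h'
      · exact absurd h.symm (hp.ne h' hl)
    cases j with
    | zero =>
      refine ⟨some i, Or.inr (Or.inr ⟨rfl, rfl⟩), ?_⟩
      rintro k (⟨_, h⟩ | ⟨l, hl, _, h⟩ | ⟨h, _⟩)
      · exact absurd rfl (h 0 hj)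
      · exact absurd (huniq _ hl h) (by omega)
      · exact h
    | succ j =>
      refine ⟨o (p j), Or.inr (Or.inl ⟨j, hj, rfl, rfl⟩), ?_⟩
      rintro k (⟨_, h⟩ | ⟨l, hl, h1, h⟩ | ⟨_, h⟩)
      · exact absurd rfl (h _ hj)
      · have := huniq _ hl h
        rw [← h1, Nat.succ_injective this]
      · exact absurd (huniq 0 (by omega) h.symm) (by omega)
  · push Not at hg
    refine ⟨o g, Or.inl ⟨rfl, hg⟩, ?_⟩
    rintro k (⟨h, _⟩ | ⟨l, hl, _, h⟩ | ⟨_, h⟩)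
    · exact h.symm
    · exact absurd h (hg _ hl)
    · exact absurd h.symm (hg 0 (by omega))

/-- The exchanges bound the rank of the new bundle from below and its cardinality from above by the
same number; since rank is at most cardinality, all are equal. -/
lemma transfer_value (hv : ∀ i, IsMRF (v i)) (hX : IsNonredundant v X)
    (hp : IsShortestTransferSeq v X i t p) (k : Fin n) :
    v k (transfer X i (fun j : Fin (t + 1) => p j) (some k)) =
        (transfer X i (fun j : Fin (t + 1) => p j) (some k)).card ∧
      (transfer X i (fun j : Fin (t + 1) => p j) (some k)).card =
        (X (some k)).card + if k = i then 1 else 0 := by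
  have hne : ∀ l < t, ∀ j < l, p j ≠ p l := fun l hl j hj => hp.ne hj hl.le
  have hmain := (hv k).card_le_partialExchange (p := p) (t := t) (hX.value k)
    (fun j hj hk => (hp.seq.2.2 j hj).notMem hv hX hk) hne
    (fun j hj hk => (hp.seq.2.2 j hj).eq_of_mem hX.alloc hk)
    (fun l hl j hj hk h => hp.not_edge (j := j) (l := l + 1) (by omega) hl
      ⟨hp.ne (by omega) hl, some k, hk, h⟩)
  have hcard := card_partialExchange_le (I := X (some k)) hne
  rw [transfer_some hv hX hp]
  split_ifs with hk
  · subst hk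
    have h1 := hmain.2 (p 0) hp.seq.1 fun j hj _ => hp.notMem_desired hj
    have h2 := (hv k).le_card (insert (p 0) (partialExchange (X (some k)) p t))
    have h3 := Finset.card_insert_le (p 0) (partialExchange (X (some k)) p t)
    have h4 : (X (some k)).card + 1 ≤ (insert (p 0) (partialExchange (X (some k)) p t)).card := by
      exact_mod_cast h1.trans h2
    have h5 : (insert (p 0) (partialExchange (X (some k)) p t)).card = (X (some k)).card + 1 := by
      omega
    refine ⟨le_antisymm h2 ?_, h5⟩
    rw [h5]; push_cast; exact h1
  · have h2 := (hv k).le_card (partialExchange (X (some k)) p t)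
    have h4 : (X (some k)).card ≤ (partialExchange (X (some k)) p t).card := by
      exact_mod_cast hmain.1.trans h2
    have h5 := le_antisymm hcard h4
    refine ⟨le_antisymm h2 ?_, by simpa using h5⟩
    rw [h5]; exact hmain.1

lemma IsNonredundant.transfer (hv : ∀ i, IsMRF (v i)) (hX : IsNonredundant v X)
    {P : Fin (t + 1) → G} (hP : IsShortestTransferPath v X i t P) :
    IsNonredundant v (transfer X i P) ∧
      ∀ k, (YankeeSwap.transfer X i P (some k)).card =
        (X (some k)).card + if k = i then 1 else 0 := by
  obtain ⟨p, rfl⟩ := exists_seq P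
  have hp := hP.seq
  exact ⟨⟨isAllocation_transfer hv hX hp, fun k => (transfer_value hv hX hp k).1⟩,
    fun k => (transfer_value hv hX hp k).2⟩

end Augment

/-! ### Tight sets of agents -/

section Tight

lemma IsAllocation.sum_card_inter_le {X : Bundles n G} (hX : IsAllocation X) (T : Finset (Fin n))
    (R : Finset G) : ∑ k ∈ T, (X (some k) ∩ R).card ≤ R.card := by
  rw [← Finset.card_biUnion]
  · exact Finset.card_le_card (Finset.biUnion_subset.mpr fun _ _ => Finset.inter_subset_right)
  · intro a _ b _ hab
    refine Finset.disjoint_left.mpr fun g hg hg' => hab ?_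
    exact Option.some_injective _
      (hX.unique (Finset.mem_inter.mp hg).1 (Finset.mem_inter.mp hg').1)

variable [Fintype G] {v : Fin n → Finset G → ℝ}

/-- A certificate that the agents in `T` cannot increase their total utility: the goods in `R` are
all allocated to agents in `T`, whose other goods span all goods outside `R`. -/
def IsTight (v : Fin n → Finset G → ℝ) (X : Bundles n G) (T : Finset (Fin n)) (R : Finset G) :
    Prop :=
  (∀ g ∈ R, ∃ k ∈ T, g ∈ X (some k)) ∧ ∀ k ∈ T, v k Rᶜ ≤ ((X (some k) \ R).card : ℝ)

lemma IsTight.card_le {X : Bundles n G} {T : Finset (Fin n)} {R : Finset G}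
    (h : IsTight v X T R) : R.card ≤ ∑ k ∈ T, (X (some k) ∩ R).card := by
  refine (Finset.card_le_card fun g hg => ?_).trans Finset.card_biUnion_le
  obtain ⟨k, hk, hgk⟩ := h.1 g hg
  exact Finset.mem_biUnion.mpr ⟨k, hk, Finset.mem_inter.mpr ⟨hgk, hg⟩⟩

/-- The easy direction of matroid union duality: `v k (Y k)` is at most `v k Rᶜ` plus the number of
goods of `R` in `Y k`, and the latter numbers add up to at most `R.card`, which `X` attains on `T`.
-/
lemma IsTight.sum_le (hv : ∀ i, IsMRF (v i)) {X Y : Bundles n G} {T : Finset (Fin n)}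
    {R : Finset G} (h : IsTight v X T R) (hY : IsAllocation Y) :
    ∑ k ∈ T, v k (Y (some k)) ≤ ((∑ k ∈ T, (X (some k)).card : ℕ) : ℝ) := by
  have h1 : ∀ k ∈ T, v k (Y (some k)) ≤ (X (some k) \ R).card + (Y (some k) ∩ R).card := by
    intro k hk
    have h2 := (hv k).union_le_add_card (Y (some k) \ R) (Y (some k) ∩ R)
    rw [Finset.sdiff_union_inter] at h2
    have h3 : v k (Y (some k) \ R) ≤ v k Rᶜ := (hv k).mono fun g hg => by
      simpa using (Finset.mem_sdiff.mp hg).2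
    linarith [h.2 k hk]
  have h2 := (Finset.sum_le_sum h1)
  have h3 : ∑ k ∈ T, (X (some k)).card =
      ∑ k ∈ T, (X (some k) \ R).card + ∑ k ∈ T, (X (some k) ∩ R).card := by
    rw [← Finset.sum_add_distrib]
    exact Finset.sum_congr rfl fun k _ => (Finset.card_sdiff_add_card_inter _ _).symm
  have h4 := (hY.sum_card_inter_le T R).trans h.card_le
  rw [Finset.sum_add_distrib] at h2
  rw [h3]
  refine h2.trans ?_
  push_cast
  refine add_le_add_right ?_ _
  exact_mod_cast h4

/-- Complementary slackness: an allocation with no smaller total on `T` attains equality throughout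
the bound given by `R`, so the same `R` certifies it. -/
lemma IsTight.of_sum_le (hv : ∀ i, IsMRF (v i)) {X X' : Bundles n G} {T : Finset (Fin n)}
    {R : Finset G} (h : IsTight v X T R) (hX' : IsNonredundant v X')
    (hle : ∑ k ∈ T, (X (some k)).card ≤ ∑ k ∈ T, (X' (some k)).card) : IsTight v X' T R := by
  have h3 : ∀ Z : Bundles n G, ∑ k ∈ T, (Z (some k)).card =
      ∑ k ∈ T, (Z (some k) \ R).card + ∑ k ∈ T, (Z (some k) ∩ R).card := by
    intro Z
    rw [← Finset.sum_add_distrib]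
    exact Finset.sum_congr rfl fun k _ => (Finset.card_sdiff_add_card_inter _ _).symm
  rw [h3 X, h3 X'] at hle
  have h4 := hX'.alloc.sum_card_inter_le T R
  have h5 := h.card_le
  have h6 : ∀ k ∈ T, ((X' (some k) \ R).card : ℝ) ≤ v k Rᶜ := by
    intro k _
    rw [← (hv k).eq_card_of_subset (hX'.value k) Finset.sdiff_subset]
    exact (hv k).mono fun g hg => by simpa using (Finset.mem_sdiff.mp hg).2
  have h7 : ∀ k ∈ T, (X' (some k) \ R).card ≤ (X (some k) \ R).card := fun k hk => by
    exact_mod_cast (h6 k hk).trans (h.2 k hk)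
  have h8 := Finset.sum_le_sum h7
  have h9 := (Finset.sum_eq_sum_iff_of_le h7).mp (by omega)
  refine ⟨?_, fun k hk => by rw [h9 k hk]; exact h.2 k hk⟩
  have h10 : (T.biUnion fun k => X' (some k) ∩ R) = R := by
    refine Finset.eq_of_subset_of_card_le
      (Finset.biUnion_subset.mpr fun _ _ => Finset.inter_subset_right) ?_
    rw [Finset.card_biUnion]
    · omega
    · intro a _ b _ hab
      refine Finset.disjoint_left.mpr fun g hg hg' => hab ?_
      exact Option.some_injective _
        (hX'.alloc.unique (Finset.mem_inter.mp hg).1 (Finset.mem_inter.mp hg').1)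
  intro g hg
  rw [← h10] at hg
  obtain ⟨k, hk, hgk⟩ := Finset.mem_biUnion.mp hg
  exact ⟨k, hk, (Finset.mem_inter.mp hgk).1⟩

/-- For an agent in both sets this is submodularity at `Rᶜ` and `R'ᶜ`. An agent in only one of them
owns nothing in the other set of goods, so its own certificate suffices. -/
lemma IsTight.union (hv : ∀ i, IsMRF (v i)) {X : Bundles n G} (hX : IsNonredundant v X)
    {T T' : Finset (Fin n)} {R R' : Finset G} (h : IsTight v X T R) (h' : IsTight v X T' R') :
    IsTight v X (T ∪ T') (R ∪ R') := by
  have hout : ∀ {T : Finset (Fin n)} {R : Finset G}, IsTight v X T R → ∀ k ∉ T,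
      ∀ g ∈ R, g ∉ X (some k) := by
    intro T R h k hk g hg hgk
    obtain ⟨l, hl, hgl⟩ := h.1 g hg
    exact hk (Option.some_injective _ (hX.alloc.unique hgl hgk) ▸ hl)
  have hone : ∀ {T T' : Finset (Fin n)} {R R' : Finset G}, IsTight v X T R → IsTight v X T' R' →
      ∀ k ∈ T, k ∉ T' → v k (R ∪ R')ᶜ ≤ ((X (some k) \ (R ∪ R')).card : ℝ) := by
    intro T T' R R' h h' k hk hk'
    have : X (some k) \ (R ∪ R') = X (some k) \ R := by
      ext g
      simp only [Finset.mem_sdiff, Finset.mem_union]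
      have := fun hg => hout h' k hk' g hg
      tauto
    rw [this]
    exact ((hv k).mono (Finset.compl_subset_compl.mpr Finset.subset_union_left)).trans (h.2 k hk)
  constructor
  · intro g hg
    rcases Finset.mem_union.mp hg with hg | hg
    · obtain ⟨k, hk, hgk⟩ := h.1 g hg
      exact ⟨k, Finset.mem_union_left _ hk, hgk⟩
    · obtain ⟨k, hk, hgk⟩ := h'.1 g hg
      exact ⟨k, Finset.mem_union_right _ hk, hgk⟩
  · intro k hk
    by_cases h1 : k ∈ T
    · by_cases h2 : k ∈ T'
      · have h3 := (hv k).union_add_inter_le Rᶜ R'ᶜ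
        have h4 := h.2 k h1
        have h5 := h'.2 k h2
        have h6 : (((X (some k) \ R) ∪ (X (some k) \ R')).card : ℝ) ≤ v k (Rᶜ ∪ R'ᶜ) := by
          rw [← (hv k).eq_card_of_subset (hX.value k)
            (Finset.union_subset Finset.sdiff_subset Finset.sdiff_subset)]
          refine (hv k).mono fun g hg => ?_
          simp only [Finset.mem_union, Finset.mem_sdiff, Finset.mem_compl] at hg ⊢
          tauto
        have h7 := Finset.card_union_add_card_inter (X (some k) \ R) (X (some k) \ R')
        have h8 : (X (some k) \ R) ∩ (X (some k) \ R') = X (some k) \ (R ∪ R') := by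
          ext g
          simp only [Finset.mem_inter, Finset.mem_sdiff, Finset.mem_union]
          tauto
        rw [h8] at h7
        have h9 : (((X (some k) \ R) ∪ (X (some k) \ R')).card : ℝ) +
            (X (some k) \ (R ∪ R')).card = (X (some k) \ R).card + (X (some k) \ R').card := by
          exact_mod_cast h7
        rw [Finset.compl_union]
        linarith
      · exact hone h h' k h1 h2
    · have h2 : k ∈ T' := (Finset.mem_union.mp hk).resolve_left h1
      rw [Finset.union_comm]
      exact hone h' h k h2 h1

lemma IsTight.biUnion (hv : ∀ i, IsMRF (v i)) {X : Bundles n G} (hX : IsNonredundant v X)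
    (T : Fin n → Finset (Fin n)) (R : Fin n → Finset G) (A : Finset (Fin n))
    (h : ∀ i ∈ A, IsTight v X (T i) (R i)) : IsTight v X (A.biUnion T) (A.biUnion R) := by
  induction A using Finset.induction_on with
  | empty => exact ⟨by simp, by simp⟩
  | insert a A ha ih =>
    rw [Finset.biUnion_insert, Finset.biUnion_insert]
    exact (h a (by simp)).union hv hX (ih fun i hi => h i (by simp [hi]))

/-- Without a transfer path for `i`, the goods reachable from `Fᵢ(X)` certify a tight set. -/
lemma exists_isTight (hv : ∀ i, IsMRF (v i)) {X : Bundles n G} (hX : IsNonredundant v X)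
    {i : Fin n} (hP : ∀ (t : ℕ) (P : Fin (t + 1) → G), ¬ IsTransferPath v X i t P) :
    ∃ T R, i ∈ T ∧ IsTight v X T R := by
  classical
  set R : Finset G := Finset.univ.filter fun g => ∃ (t : ℕ) (p : ℕ → G), p 0 ∈ desired v X i ∧
    p t = g ∧ ∀ j < t, ExchangeEdge v X (p j) (p (j + 1)) with hR
  have hmem : ∀ g, g ∈ R ↔ ∃ (t : ℕ) (p : ℕ → G), p 0 ∈ desired v X i ∧
    p t = g ∧ ∀ j < t, ExchangeEdge v X (p j) (p (j + 1)) := fun g => by simp [hR]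
  have hF : ∀ g ∈ desired v X i, g ∈ R := fun g hg =>
    (hmem g).mpr ⟨0, fun _ => g, hg, rfl, by simp⟩
  have hclosed : ∀ g ∈ R, ∀ g', ExchangeEdge v X g g' → g' ∈ R := by
    intro g hg g' he
    obtain ⟨t, p, h0, rfl, hp⟩ := (hmem g).mp hg
    refine (hmem g').mpr ⟨t + 1, fun m => if m ≤ t then p m else g', by simpa using h0,
      by simp, fun j hj => ?_⟩
    rcases (Nat.lt_succ_iff.mp hj).lt_or_eq with hj | rfl
    · simp only [if_pos hj.le, if_pos (Nat.succ_le_of_lt hj)]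
      exact hp j hj
    · simpa using he
  have hpool : ∀ g ∈ R, g ∉ X none := by
    intro g hg hg0
    obtain ⟨t, p, h0, rfl, hp⟩ := (hmem g).mp hg
    exact hP t _ (IsTransferSeq.isTransferPath ⟨h0, hg0, hp⟩)
  refine ⟨Finset.univ.filter fun k => k = i ∨ (X (some k) ∩ R).Nonempty, R, by simp, ?_, ?_⟩
  · intro g hg
    obtain ⟨k, hk⟩ := (hX.alloc g).exists
    cases k with
    | none => exact absurd hk (hpool g hg)
    | some k =>
      exact ⟨k, by simp; exact Or.inr ⟨g, Finset.mem_inter.mpr ⟨hk, hg⟩⟩, hk⟩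
  · intro k hk
    have hI := hX.value k
    have hIR := (hv k).eq_card_of_subset hI (Finset.sdiff_subset (t := R))
    rw [← hIR]
    refine ((hv k).mono (Finset.subset_union_right (s₁ := X (some k) \ R))).trans ?_
    refine (hv k).union_eq_of_insert_le _ _ fun g hg => ?_
    have hgR : g ∉ R := by simpa using hg
    by_cases hgX : g ∈ X (some k)
    · rw [Finset.insert_eq_of_mem (Finset.mem_sdiff.mpr ⟨hgX, hgR⟩)]
    -- If `k` owns goods of `R`, no edge leads from them to `g ∉ R`, so the rest of the bundle spans
    -- `g`. If not, then `k = i`, and `g` has no marginal gain because `R` contains `Fᵢ(X)`.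
    by_cases hne : (X (some k) ∩ R).Nonempty
    · have h1 := (hv k).insert_sdiff_le (b := g) hI Finset.inter_subset_left hne (by
        intro a ha
        obtain ⟨haX, haR⟩ := Finset.mem_inter.mp ha
        refine (hv k).insert_erase_le hI haX fun h => hgR ?_
        exact hclosed a haR g ⟨fun h => hgX (h ▸ haX), some k, haX, h⟩)
      rw [Finset.sdiff_inter_self_left] at h1
      have h2 : ((X (some k) \ R).card : ℝ) + (X (some k) ∩ R).card = (X (some k)).card := by
        exact_mod_cast Finset.card_sdiff_add_card_inter (X (some k)) R
      linarith
    · obtain rfl : k = i := by simpa [hne] using hk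
      have : X (some k) \ R = X (some k) := by
        rw [Finset.sdiff_eq_self_iff_disjoint, Finset.disjoint_iff_inter_eq_empty]
        exact Finset.not_nonempty_iff_eq_empty.mp hne
      rw [this]
      rcases (hv k).marginal (X (some k)) g with h | h
      · linarith
      · exact absurd (hF g h) hgR

end Tight

end YankeeSwap

/-! ### Leximin comparison by exponential sums -/

namespace YankeeSwap

/-- The key `(m / w k, w k)` of an agent `k` with utility `m` precedes the key of `i` with
utility `m'` in the lexicographic order. -/
def KeyLE {n : ℕ} (w : Fin n → ℝ) (k : Fin n) (m : ℝ) (i : Fin n) (m' : ℝ) : Prop :=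
  m / w k < m' / w i ∨ (m / w k = m' / w i ∧ w k ≤ w i)

lemma KeyLE.trans {n : ℕ} {w : Fin n → ℝ} {k i j : Fin n} {a b c : ℝ} (h : KeyLE w k a i b)
    (h' : KeyLE w i b j c) : KeyLE w k a j c := by
  unfold KeyLE at *
  rcases h with h | ⟨h, h1⟩ <;> rcases h' with h' | ⟨h', h2⟩
  · exact Or.inl (h.trans h')
  · exact Or.inl (h' ▸ h)
  · exact Or.inl (h ▸ h')
  · exact Or.inr ⟨h.trans h', h1.trans h2⟩

lemma KeyLE.of_le {n : ℕ} {w : Fin n → ℝ} (hw : ∀ i, 0 < w i) (i : Fin n) {a b : ℝ}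
    (h : a ≤ b) : KeyLE w i a i b := by
  rcases h.lt_or_eq with h | rfl
  · exact Or.inl (div_lt_div_of_pos_right h (hw i))
  · exact Or.inr ⟨rfl, le_rfl⟩

/-- The decrease of `exp (-s m / w)` when `m` grows by one. -/
noncomputable def expGain (s w m : ℝ) : ℝ := Real.exp (-s * (m / w)) * (1 - Real.exp (-s / w))

open Filter Topology

lemma tendsto_exp_neg_mul {d : ℝ} (hd : 0 < d) :
    Tendsto (fun s : ℝ => Real.exp (-s * d)) atTop (𝓝 0) := by
  refine Real.tendsto_exp_atBot.comp ?_
  exact (tendsto_neg_atTop_atBot).atBot_mul_const hd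

lemma expGain_nonneg {s w : ℝ} (hs : 0 ≤ s) (hw : 0 < w) (m : ℝ) : 0 ≤ expGain s w m := by
  unfold expGain
  refine mul_nonneg (Real.exp_pos _).le (sub_nonneg.mpr (Real.exp_le_one_iff.mpr ?_))
  exact div_nonpos_of_nonpos_of_nonneg (by linarith) hw.le

/-- A smaller ratio wins exponentially. At equal ratios only the factor `1 - exp (-s / w)` differs,
and it is larger for the smaller weight; this is what the tie-break `-wᵢ` is for. -/
lemma KeyLE.eventually_expGain_le {n : ℕ} {w : Fin n → ℝ} (hw : ∀ i, 0 < w i) {k i : Fin n}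
    {a b : ℝ} (h : KeyLE w k a i b) :
    ∀ᶠ s in atTop, expGain s (w i) b ≤ expGain s (w k) a := by
  rcases h with h | ⟨h, h1⟩
  · have hd : 0 < b / w i - a / w k := sub_pos.mpr h
    have h1 := tendsto_exp_neg_mul hd
    have h2 := tendsto_exp_neg_mul (d := 1 / w k) (one_div_pos.mpr (hw k))
    have h3 := (h1.add h2).eventually_lt_const (by norm_num : (0 : ℝ) + 0 < 1)
    filter_upwards [h3, eventually_ge_atTop 0] with s hs hs0
    unfold expGain
    have e1 : Real.exp (-s * (b / w i)) = Real.exp (-s * (a / w k)) *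
        Real.exp (-s * (b / w i - a / w k)) := by
      rw [← Real.exp_add]; congr 1; ring
    have e2 : -s / w k = -s * (1 / w k) := by ring
    rw [e1, e2, mul_assoc]
    refine mul_le_mul_of_nonneg_left ?_ (Real.exp_pos _).le
    have h4 : Real.exp (-s * (b / w i - a / w k)) * (1 - Real.exp (-s / w i)) ≤
        Real.exp (-s * (b / w i - a / w k)) * 1 :=
      mul_le_mul_of_nonneg_left (by linarith [Real.exp_pos (-s / w i)]) (Real.exp_pos _).le
    linarith
  · filter_upwards [eventually_ge_atTop 0] with s hs
    unfold expGain
    rw [h]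
    refine mul_le_mul_of_nonneg_left ?_ (Real.exp_pos _).le
    have : s / w i ≤ s / w k := div_le_div_of_nonneg_left hs (hw k) h1
    have : -s / w k ≤ -s / w i := by rw [neg_div, neg_div]; linarith
    linarith [Real.exp_le_exp.mpr this]

/-- Convexity in the utility: `-l` is a subgradient at `u`. At `u = 0` no bound from the left is
needed, since `y` cannot be smaller. -/
lemma exp_sub_exp_le {s w l : ℝ} (hs : 0 ≤ s) (hw : 0 < w) (u y : ℕ)
    (h1 : expGain s w u ≤ l) (h2 : 1 ≤ u → l ≤ expGain s w ((u : ℝ) - 1)) :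
    Real.exp (-s * (u / w)) - Real.exp (-s * (y / w)) ≤ l * ((y : ℝ) - u) := by
  set E := Real.exp (-s / w) with hE
  have hE1 : E ≤ 1 := Real.exp_le_one_iff.mpr
    (div_nonpos_of_nonpos_of_nonneg (by linarith) hw.le)
  have hE0 : 0 < E := Real.exp_pos _
  have hpow : ∀ m : ℕ, Real.exp (-s * (m / w)) = E ^ m := by
    intro m
    rw [hE, ← Real.exp_nat_mul]; congr 1; ring
  rw [hpow, hpow]
  unfold expGain at h1 h2
  rw [hpow] at h1
  rcases le_total u y with h | h
  · obtain ⟨d, rfl⟩ := Nat.exists_eq_add_of_le h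
    -- Bernoulli's inequality for `E = 1 + (E - 1)`.
    have hb := one_add_mul_le_pow (a := E - 1) (by linarith) d
    simp only [add_sub_cancel] at hb
    rw [pow_add]
    push_cast
    have h3 : E ^ u * (1 - E ^ d) ≤ E ^ u * (d * (1 - E)) :=
      mul_le_mul_of_nonneg_left (by linarith) (by positivity)
    have h4 : d * (E ^ u * (1 - E)) ≤ d * l := mul_le_mul_of_nonneg_left h1 (by positivity)
    linarith
  · rcases h.eq_or_lt with rfl | hlt
    · simp
    obtain ⟨d, rfl⟩ := Nat.exists_eq_add_of_lt hlt
    have h3 := h2 (by omega)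
    have e : ((y + d + 1 : ℕ) : ℝ) - 1 = ((y + d : ℕ) : ℝ) := by push_cast; ring
    rw [e, hpow] at h3
    -- The `d + 1` unit steps from `y` to `u` each decrease the power by at least as much as the
    -- last one.
    have h4 : ∀ d : ℕ, ((d : ℝ) + 1) * (E ^ (y + d) * (1 - E)) ≤ E ^ y - E ^ (y + d + 1) := by
      intro d
      induction d with
      | zero => simp; ring_nf; rfl
      | succ d ih =>
        have h5 : E ^ (y + (d + 1)) ≤ E ^ (y + d) :=
          pow_le_pow_of_le_one hE0.le hE1 (by omega)
        have h6 : ((d : ℝ) + 1) * (E ^ (y + (d + 1)) * (1 - E)) ≤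
            ((d : ℝ) + 1) * (E ^ (y + d) * (1 - E)) := by
          refine mul_le_mul_of_nonneg_left (mul_le_mul_of_nonneg_right h5 (by linarith))
            (by positivity)
        have h7 : E ^ (y + (d + 1) + 1) = E ^ (y + (d + 1)) * E := pow_succ _ _
        have h8 : E ^ (y + d + 1) = E ^ (y + (d + 1)) := by ring_nf
        rw [h8] at ih
        rw [h7]
        push_cast
        linarith
    have h5 := h4 d
    have h6 : ((d : ℝ) + 1) * l ≤ ((d : ℝ) + 1) * (E ^ (y + d) * (1 - E)) :=
      mul_le_mul_of_nonneg_left h3 (by positivity)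
    push_cast
    linarith

/-- After sorting, the terms before the first difference `k` cancel. The remaining terms of `y` add
up to at most `n * exp (-s * y' k)`, which is eventually below the single term `exp (-s * x' k)`. -/
lemma LexDominates.eventually_sum_exp_lt {n : ℕ} {x y : Fin n → ℝ}
    (h : LexDominates (y ∘ Tuple.sort y) (x ∘ Tuple.sort x)) :
    ∀ᶠ s : ℝ in atTop, ∑ i, Real.exp (-s * y i) < ∑ i, Real.exp (-s * x i) := by
  obtain ⟨k, heq, hlt⟩ := h
  have hy := Tuple.monotone_sort y
  set y' := y ∘ Tuple.sort y with hy'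
  set x' := x ∘ Tuple.sort x with hx'
  have hd : 0 < y' k - x' k := sub_pos.mpr hlt
  have h1 := ((tendsto_exp_neg_mul hd).const_mul (n : ℝ)).eventually_lt_const
    (by simp : (n : ℝ) * 0 < 1)
  filter_upwards [h1, eventually_ge_atTop 0] with s hs hs0
  have ey : ∑ i, Real.exp (-s * y i) = ∑ i, Real.exp (-s * y' i) :=
    (Equiv.sum_comp (Tuple.sort y) fun i => Real.exp (-s * y i)).symm
  have ex : ∑ i, Real.exp (-s * x i) = ∑ i, Real.exp (-s * x' i) :=
    (Equiv.sum_comp (Tuple.sort x) fun i => Real.exp (-s * x i)).symm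
  rw [ey, ex, ← Finset.sum_filter_add_sum_filter_not Finset.univ (fun j => j < k),
    ← Finset.sum_filter_add_sum_filter_not Finset.univ (fun j => j < k)
      (fun i => Real.exp (-s * x' i))]
  have e1 : ∑ j ∈ Finset.univ.filter (fun j => j < k), Real.exp (-s * y' j) =
      ∑ j ∈ Finset.univ.filter (fun j => j < k), Real.exp (-s * x' j) :=
    Finset.sum_congr rfl fun j hj => by rw [heq j (Finset.mem_filter.mp hj).2]
  rw [e1]
  refine add_lt_add_right ?_ _
  have h2 : ∑ j ∈ Finset.univ.filter (fun j => ¬ j < k), Real.exp (-s * y' j) ≤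
      n * Real.exp (-s * y' k) := by
    calc _ ≤ ∑ j ∈ Finset.univ.filter (fun j => ¬ j < k), Real.exp (-s * y' k) := by
          refine Finset.sum_le_sum fun j hj => Real.exp_le_exp.mpr ?_
          have := hy (not_lt.mp (Finset.mem_filter.mp hj).2)
          nlinarith
      _ ≤ _ := by
          rw [Finset.sum_const, nsmul_eq_mul]
          refine mul_le_mul_of_nonneg_right ?_ (Real.exp_pos _).le
          exact_mod_cast (Finset.card_filter_le _ _).trans (by simp)
  have h3 : Real.exp (-s * x' k) ≤
      ∑ j ∈ Finset.univ.filter (fun j => ¬ j < k), Real.exp (-s * x' j) :=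
    Finset.single_le_sum (f := fun j => Real.exp (-s * x' j))
      (fun j _ => (Real.exp_pos _).le) (by simp)
  have e2 : Real.exp (-s * y' k) = Real.exp (-s * (y' k - x' k)) * Real.exp (-s * x' k) := by
    rw [← Real.exp_add]; congr 1; ring
  have h4 := mul_lt_mul_of_pos_right hs (Real.exp_pos (-s * x' k))
  rw [e2] at h2
  linarith

/-- A layer-cake argument: `l` is a nonnegative combination of indicators of its superlevel sets,
peeled off one at a time. -/
lemma sum_mul_nonpos_of_superlevel {ι : Type*} [Fintype ι] (l d : ι → ℝ) (hl : ∀ i, 0 ≤ l i)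
    (h : ∀ θ > 0, ∑ i ∈ Finset.univ.filter (fun i => θ ≤ l i), d i ≤ 0) :
    ∑ i, l i * d i ≤ 0 := by
  induction hN : (Finset.univ.filter fun i => 0 < l i).card using Nat.strong_induction_on
    generalizing l with
  | _ N ih =>
  subst hN
  rcases (Finset.univ.filter fun i => 0 < l i).eq_empty_or_nonempty with hS | hS
  · refine (Finset.sum_eq_zero fun i _ => ?_).le
    have : i ∉ Finset.univ.filter fun i => 0 < l i := by rw [hS]; simp
    have : l i = 0 := le_antisymm (by simpa using this) (hl i)
    simp [this]
  · obtain ⟨a, ha, hmin⟩ := Finset.exists_min_image _ l hS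
    have ha0 : 0 < l a := by simpa using ha
    have hmin' : ∀ i, 0 < l i → l a ≤ l i := fun i hi => hmin i (by simpa using hi)
    -- Subtracting the least positive value kills at least one entry; the superlevel set of `l'` at
    -- `θ > 0` is that of `l` at `θ + l a`.
    set l' : ι → ℝ := fun i => if 0 < l i then l i - l a else 0 with hl'
    have hsum : ∑ i, l i * d i = ∑ i, l' i * d i +
        l a * ∑ i ∈ Finset.univ.filter (fun i => l a ≤ l i), d i := by
      rw [Finset.mul_sum, Finset.sum_filter, ← Finset.sum_add_distrib]
      refine Finset.sum_congr rfl fun i _ => ?_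
      by_cases hi : 0 < l i
      · simp only [hl', if_pos hi, if_pos (hmin' i hi)]; ring
      · have h0 : l i = 0 := le_antisymm (not_lt.mp hi) (hl i)
        have : ¬ l a ≤ l i := by rw [h0]; exact not_le.mpr ha0
        simp [hl', h0, ha0]
    have h1 := h (l a) ha0
    have h2 : ∑ i, l' i * d i ≤ 0 := by
      refine ih _ ?_ l' ?_ ?_ rfl
      · refine Finset.card_lt_card (Finset.ssubset_iff_of_subset ?_ |>.mpr ⟨a, ha, ?_⟩)
        · intro i hi
          simp only [Finset.mem_filter, Finset.mem_univ, true_and, hl'] at hi ⊢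
          by_contra hn
          simp [hn] at hi
        · simp [hl', ha0]
      · intro i
        by_cases hi : 0 < l i
        · simp only [hl', if_pos hi]; linarith [hmin' i hi]
        · simp [hl', hi]
      · intro θ hθ
        convert h (θ + l a) (by linarith) using 2
        ext i
        simp only [Finset.mem_filter, Finset.mem_univ, true_and, hl']
        by_cases hi : 0 < l i
        · rw [if_pos hi]; constructor <;> intro <;> linarith
        · rw [if_neg hi]; constructor <;> intro <;> linarith [hl i]
    rw [hsum]
    nlinarith

/-- If every agent `i` lies in a set `T i` on whose unions `u` has maximal total among the vectors
considered, and no agent of `T i` precedes `i` by more than a unit, then `u` is leximin. -/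
lemma not_lexDominates_of_tight {n : ℕ} {w : Fin n → ℝ} (hw : ∀ i, 0 < w i) (u y : Fin n → ℕ)
    (T : Fin n → Finset (Fin n)) (hT : ∀ i, i ∈ T i)
    (hkey : ∀ i, ∀ k ∈ T i, 1 ≤ u k → KeyLE w k ((u k : ℝ) - 1) i (u i))
    (hsum : ∀ A : Finset (Fin n), ∑ k ∈ A.biUnion T, y k ≤ ∑ k ∈ A.biUnion T, u k) :
    ¬ LexDominates ((fun i => (y i : ℝ) / w i) ∘ Tuple.sort fun i => (y i : ℝ) / w i)
      ((fun i => (u i : ℝ) / w i) ∘ Tuple.sort fun i => (u i : ℝ) / w i) := by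
  intro hdom
  have h1 := hdom.eventually_sum_exp_lt
  have h2 : ∀ᶠ s in atTop, ∀ i, ∀ k, k ∈ T i → 1 ≤ u k →
      expGain s (w i) (u i) ≤ expGain s (w k) ((u k : ℝ) - 1) := by
    rw [eventually_all]; intro i
    rw [eventually_all]; intro k
    by_cases hk : k ∈ T i
    · by_cases hu : 1 ≤ u k
      · filter_upwards [(hkey i k hk hu).eventually_expGain_le hw] with s hs _ _ using hs
      · exact Eventually.of_forall fun s _ h => absurd h hu
    · exact Eventually.of_forall fun s h => absurd h hk
  obtain ⟨s, hs1, hs2, hs0⟩ := (h1.and (h2.and (eventually_ge_atTop 0))).exists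
  have hne : ∀ k, (Finset.univ.filter fun i => k ∈ T i).Nonempty := fun k => ⟨k, by simp [hT]⟩
  -- The price of `k` is the largest next decrease among the agents `i` with `k ∈ T i`. The choice
  -- `i = k` bounds it below, and `hkey`, through `hs2`, bounds it above by the last decrease of
  -- `k`.
  set l : Fin n → ℝ := fun k => (Finset.univ.filter fun i => k ∈ T i).sup' (hne k)
    fun i => expGain s (w i) (u i) with hl
  have hl1 : ∀ k, expGain s (w k) (u k) ≤ l k := fun k =>
    Finset.le_sup' (fun i => expGain s (w i) (u i)) (by simp [hT])
  have hl2 : ∀ k, 1 ≤ u k → l k ≤ expGain s (w k) ((u k : ℝ) - 1) := fun k hk =>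
    Finset.sup'_le _ _ fun i hi => hs2 i k (by simpa using hi) hk
  have h3 : ∑ k, l k * ((y k : ℝ) - u k) ≤ 0 := by
    refine sum_mul_nonpos_of_superlevel l _
      (fun k => (expGain_nonneg hs0 (hw k) _).trans (hl1 k)) fun θ _ => ?_
    have : (Finset.univ.filter fun k => θ ≤ l k) =
        (Finset.univ.filter fun i => θ ≤ expGain s (w i) (u i)).biUnion T := by
      ext k
      simp [hl, Finset.le_sup'_iff, and_comm]
    rw [this, Finset.sum_sub_distrib, sub_nonpos]
    exact_mod_cast hsum _
  have h4 : ∑ k, (Real.exp (-s * (u k / w k)) - Real.exp (-s * (y k / w k))) ≤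
      ∑ k, l k * ((y k : ℝ) - u k) :=
    Finset.sum_le_sum fun k _ => exp_sub_exp_le hs0 (hw k) _ _ (hl1 k) (hl2 k)
  rw [Finset.sum_sub_distrib] at h4
  linarith

end YankeeSwap

/-! ### The loop invariant and termination -/

namespace YankeeSwap

variable {n : ℕ} {G : Type*} {v : Fin n → Finset G → ℝ} {w : Fin n → ℝ}

lemma lexDominates_pair {a b c d : ℝ} :
    LexDominates ![a, b] ![c, d] ↔ c < a ∨ (a = c ∧ d < b) := by
  constructor
  · rintro ⟨k, h, hk⟩
    fin_cases k
    · exact Or.inl (by simpa using hk)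
    · exact Or.inr ⟨by simpa using h 0 (by simp), by simpa using hk⟩
  · rintro (h | ⟨h, h'⟩)
    · exact ⟨0, by simp, by simpa using h⟩
    · refine ⟨1, fun j hj => ?_, by simpa using h'⟩
      obtain rfl : j = 0 := Fin.lt_one_iff j |>.mp hj
      simpa using h

lemma not_lexDominates_gain_iff {x : Fin n → ℝ} {i j : Fin n} :
    ¬ LexDominates (weightedLeximinGain w x j) (weightedLeximinGain w x i) ↔
      KeyLE w i (x i) j (x j) := by
  unfold weightedLeximinGain KeyLE
  rw [lexDominates_pair, not_or, not_and, not_lt, not_lt, neg_le_neg_iff, neg_le_neg_iff, neg_inj,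
    le_iff_lt_or_eq]
  constructor
  · rintro ⟨h | h, h'⟩
    · exact Or.inl h
    · exact Or.inr ⟨h, h' h.symm⟩
  · rintro (h | ⟨h, h'⟩)
    · exact ⟨Or.inl h, fun h' => absurd h' h.ne'⟩
    · exact ⟨Or.inr h, fun _ => h'⟩

lemma IsPicked.keyLE {X : Bundles n G} {U : Finset (Fin n)} {i : Fin n}
    (h : IsPicked v (weightedLeximinGain w) X U i) (hX : IsNonredundant v X) {j : Fin n}
    (hj : j ∈ U) : KeyLE w i (X (some i)).card j (X (some j)).card := by
  have h1 := not_lexDominates_gain_iff.mp (h.1.2 j hj)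
  simp only [utility, hX.value] at h1
  exact h1

lemma exists_isPicked (v : Fin n → Finset G → ℝ) (w : Fin n → ℝ) (X : Bundles n G)
    {U : Finset (Fin n)} (hU : U.Nonempty) :
    ∃ i, IsPicked v (weightedLeximinGain w) X U i := by
  obtain ⟨a, ha, hmin⟩ := Finset.exists_min_image U
    (fun i => toLex (utility v X i / w i, w i)) hU
  have hne : {k | k ∈ U ∧ ∀ j ∈ U, ¬ LexDominates (weightedLeximinGain w (utility v X) j)
      (weightedLeximinGain w (utility v X) k)}.Nonempty := by
    refine ⟨a, ha, fun j hj => not_lexDominates_gain_iff.mpr ?_⟩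
    have h := hmin j hj
    rw [Prod.Lex.toLex_le_toLex] at h
    exact h
  obtain ⟨i, hi, hi'⟩ := Set.exists_min_image _ id (Set.toFinite _) hne
  exact ⟨i, hi, hi'⟩

variable [Fintype G] [DecidableEq G]

/-- The invariant of the loop: the agents in `U` are at most one unit behind the others, and every
agent outside `U` belongs to a tight set in which it is at most one unit ahead. -/
structure Invariant (v : Fin n → Finset G → ℝ) (w : Fin n → ℝ)
    (s : Bundles n G × Finset (Fin n)) : Prop where
  nonredundant : IsNonredundant v s.1
  active : ∀ i ∈ s.2, ∀ k, 1 ≤ (s.1 (some k)).card →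
    KeyLE w k (((s.1 (some k)).card : ℝ) - 1) i (s.1 (some i)).card
  removed : ∀ i ∉ s.2, ∃ T R, i ∈ T ∧ IsTight v s.1 T R ∧ ∀ k ∈ T, 1 ≤ (s.1 (some k)).card →
    KeyLE w k (((s.1 (some k)).card : ℝ) - 1) i (s.1 (some i)).card

lemma invariant_initialState (hv : ∀ i, IsMRF (v i)) : Invariant v w (initialState n G) where
  nonredundant := by
    refine ⟨fun g => ⟨none, by simp [initialState], fun k hk => ?_⟩, fun i => ?_⟩
    · by_contra h
      simp [initialState, h] at hk
    · simp [initialState, (hv i).empty]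
  active := by
    intro i _ k hk
    simp [initialState] at hk
  removed := by
    intro i hi
    simp [initialState] at hi

/-- The second conjunct says that the number of goods held by agents minus the size of `U` grows by
exactly one per iteration, which yields termination. -/
lemma Invariant.step (hv : ∀ i, IsMRF (v i)) (hw : ∀ i, 0 < w i)
    {s s' : Bundles n G × Finset (Fin n)} (h : Invariant v w s)
    (hs : Step v (weightedLeximinGain w) s s') :
    Invariant v w s' ∧
      (∑ k, (s.1 (some k)).card) + s'.2.card + 1 = (∑ k, (s'.1 (some k)).card) + s.2.card := by
  cases hs with
  | augment X U i t P hi hP =>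
    have hX : IsNonredundant v X := h.nonredundant
    obtain ⟨hX', hcard⟩ := hX.transfer hv hP
    have hmono : ∀ k, (X (some k)).card ≤ (transfer X i P (some k)).card := fun k => by
      rw [hcard]; omega
    refine ⟨⟨hX', fun j hj k hk => ?_, fun j hj => ?_⟩, ?_⟩
    · refine KeyLE.trans (i := j) (b := (X (some j)).card) ?_
        (KeyLE.of_le hw j (by exact_mod_cast hmono j))
      by_cases hki : k = i
      · subst hki
        -- The new bundle of the picked agent less one unit has its old key, which was least in `U`.
        have := hi.keyLE hX hj
        simpa [hcard] using this
      · simp only [hcard, if_neg hki, add_zero] at hk ⊢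
        exact h.active j hj k hk
    · obtain ⟨T, R, hjT, hT, hkey⟩ := h.removed j hj
      -- The total on a tight set cannot grow and no utility drops, so the augmentation changes no
      -- utility in `T`.
      have hsum := hT.sum_le hv hX'.alloc
      simp only [hX'.value] at hsum
      have hsum' : ∑ k ∈ T, (transfer X i P (some k)).card ≤ ∑ k ∈ T, (X (some k)).card := by
        exact_mod_cast hsum
      have heq := (Finset.sum_eq_sum_iff_of_le fun k _ => hmono k).mp
        (le_antisymm (Finset.sum_le_sum fun k (_ : k ∈ T) => hmono k) hsum')
      refine ⟨T, R, hjT, hT.of_sum_le hv hX' (Finset.sum_le_sum fun k _ => hmono k), ?_⟩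
      intro k hk hk1
      simp only [← heq k hk, ← heq j hjT] at hk1 ⊢
      exact hkey k hk hk1
    · simp only [hcard, Finset.sum_add_distrib, Finset.sum_ite_eq', Finset.mem_univ, if_true]
      ring
  | remove X U i hi hP =>
    refine ⟨⟨h.nonredundant, fun j hj => h.active j (Finset.mem_of_mem_erase hj),
      fun j hj => ?_⟩, ?_⟩
    · by_cases hji : j = i
      · subst hji
        obtain ⟨T, R, hjT, hT⟩ := exists_isTight hv h.nonredundant hP
        -- The comparison held while `j` was active, with every agent; it is kept for the agents of
        -- `T`.
        exact ⟨T, R, hjT, hT, fun k _ => h.active j hi.1.1 k⟩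
      · exact h.removed j fun hjU => hj (Finset.mem_erase.mpr ⟨hji, hjU⟩)
    · simp only [add_assoc, Finset.card_erase_add_one hi.1.1]

lemma Reachable.invariant (hv : ∀ i, IsMRF (v i)) (hw : ∀ i, 0 < w i)
    {s : Bundles n G × Finset (Fin n)} (hs : Reachable v (weightedLeximinGain w) s) :
    Invariant v w s := by
  induction hs with
  | refl => exact invariant_initialState hv
  | tail _ hstep ih => exact (ih.step hv hw hstep).1

lemma exists_step (v : Fin n → Finset G → ℝ) (w : Fin n → ℝ) (X : Bundles n G)
    {U : Finset (Fin n)} (hU : U.Nonempty) : ∃ s', Step v (weightedLeximinGain w) (X, U) s' := by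
  classical
  obtain ⟨i, hi⟩ := exists_isPicked v w X hU
  by_cases hP : ∃ t, ∃ P : Fin (t + 1) → G, IsTransferPath v X i t P
  · obtain ⟨P, hP'⟩ := Nat.find_spec hP
    exact ⟨_, Step.augment X U i _ P hi ⟨hP', fun t' P' h => Nat.find_min' hP ⟨P', h⟩⟩⟩
  · push Not at hP
    exact ⟨_, Step.remove X U i hi hP⟩

lemma terminates (hv : ∀ i, IsMRF (v i)) (hw : ∀ i, 0 < w i) :
    Terminates v (weightedLeximinGain w) := by
  refine ⟨?_, fun s _ hU => exists_step v w s.1 hU⟩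
  rintro ⟨s, h0, hs⟩
  have hinv : ∀ r, Invariant v w (s r) := by
    intro r
    induction r with
    | zero => rw [h0]; exact invariant_initialState hv
    | succ r ih => exact (ih.step hv hw (hs r)).1
  have hpot : ∀ r, r + (s r).2.card ≤ (∑ k, ((s r).1 (some k)).card) + n := by
    intro r
    induction r with
    | zero =>
      have := Finset.card_le_univ (s 0).2
      rw [Fintype.card_fin] at this
      omega
    | succ r ih =>
      have := ((hinv r).step hv hw (hs r)).2
      omega
  have hbound : ∀ r, (∑ k, ((s r).1 (some k)).card) ≤ Fintype.card G := by
    intro r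
    simpa using (hinv r).nonredundant.alloc.sum_card_inter_le Finset.univ Finset.univ
  have h1 := hpot (Fintype.card G + n + 1)
  have h2 := hbound (Fintype.card G + n + 1)
  omega

lemma isWeightedLeximin_of_invariant (hv : ∀ i, IsMRF (v i)) (hw : ∀ i, 0 < w i)
    {X : Bundles n G} (h : Invariant v w (X, ∅)) : IsWeightedLeximin v w X := by
  have hX : IsNonredundant v X := h.nonredundant
  refine ⟨hX.alloc, fun Y hY => ?_⟩
  choose T R hiT hT hkey using fun i => h.removed i (by simp)
  -- The competitor `Y` may be redundant, so its values, not its cardinalities, enter the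
  -- comparison.
  choose y hy using fun i => (hv i).exists_nat (Y (some i))
  have hmain := not_lexDominates_of_tight hw (fun i => (X (some i)).card) y T hiT hkey fun A => by
    have h1 := (IsTight.biUnion hv hX T R A fun i _ => hT i).sum_le hv hY
    simp only [hy] at h1
    exact_mod_cast h1
  have e1 : weightedUtility v w X = fun i => ((X (some i)).card : ℝ) / w i := by
    ext i; simp only [weightedUtility, hX.value]
  have e2 : weightedUtility v w Y = fun i => (y i : ℝ) / w i := by
    ext i; simp only [weightedUtility, hy]
  simpa only [sortedWeightedUtility, e1, e2] using hmain

end YankeeSwap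

theorem mainTheorem6 {n : ℕ} {G : Type*} [Fintype G] [DecidableEq G]
    (v : Fin n → Finset G → ℝ) (hv : ∀ i, YankeeSwap.IsMRF (v i))
    (w : Fin n → ℝ) (hw : ∀ i, 0 < w i) :
    YankeeSwap.Terminates v (YankeeSwap.weightedLeximinGain w) ∧
      ∀ X : YankeeSwap.Bundles n G,
        YankeeSwap.IsOutput v (YankeeSwap.weightedLeximinGain w) X →
          YankeeSwap.IsWeightedLeximin v w X :=
  ⟨YankeeSwap.terminates hv hw, fun _ hX =>
    YankeeSwap.isWeightedLeximin_of_invariant hv hw (YankeeSwap.Reachable.invariant hv hw hX)⟩
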